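/- Let $A$ be a deterministic finite automaton over an alphabet $\Sigma$, with a possibly partial transition function, an initial state and a set of accepting states. Write $pw$ for the state reached from the state $p$ by reading the word $w$, if it is defined. Suppose that $A$ is reduced (every state is reachable from the initial state, and distinct states $p,q$ have different right languages $\{w\in\Sigma^*: pw \text{ is an accepting state}\}$) and that its state transition graph is strongly connected. For a positive integer $k$, $A$ is called $k$-testable if, for all nonempty words $u,v$ that have the same prefix of length $k-1$, the same suffix of length $k-1$ (the prefix or suffix being the whole word if the word is shorter) and the same set of factors of length $k$, the word $u$ is accepted by $A$ if and only if $v$ is. $A$ is locally testable if it is $k$-testable for some $k\ge 1$, and precisely $k$-testable if $k$ is the least positive integer for which it is $k$-testable. The 2-tuple graph of $A$ has as nodes the pairs $(p,q)$ of distinct states such that $q$ is reachable from $p$, and it has an edge labelled $\sigma\in\Sigma$ from $(p,q)$ to $(r,t)$ whenever $p\sigma=r$ and $q\sigma=t$. A path on this graph (its length, possibly $0$, is its number of edges) is simple if it does not repeat a node, and strongly simple if none of its nodes lies on a closed path of positive length, that is, in a strongly connected component containing an edge. Suppose that $A$ is locally testable, and let $k\ge 2$. If the maximum of the lengths of the strongly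 simple paths on the 2-tuple graph of $A$ exists and equals $k-2$, then $A$ is precisely $k$-testable. Likewise, if the maximum of the lengths of the simple paths on the 2-tuple graph exists and equals $k-2$, then $A$ is precisely $k$-testable. -/

import Mathlib

/-- Two words have the same prefix of length `k - 1`, the same suffix of length `k - 1` (the whole
word, if it is shorter) and the same set of factors of length `k`. Only used for `k ≥ 1`. -/
def SameTestData {α : Type*} (k : ℕ) (u v : List α) : Prop :=
  u.take (k - 1) = v.take (k - 1) ∧
  u.rtake (k - 1) = v.rtake (k - 1) ∧
  {w : List α | w <:+: u ∧ w.length = k} = {w : List α | w <:+: v ∧ w.length = k}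

/-- A language is `k`-testable (`k` a positive integer) if membership of a nonempty word depends
only on its prefix and suffix of length `k - 1` and on its set of factors of length `k`. -/
def Language.IsKTestable {α : Type*} (k : ℕ) (L : Language α) : Prop :=
  0 < k ∧ ∀ u v : List α, u ≠ [] → v ≠ [] → SameTestData k u v → (u ∈ L ↔ v ∈ L)

/-- A deterministic automaton whose transition function may be partial
(`step p a = none` means that `p a` is undefined). -/
structure PartialDFA (α σ : Type*) where
  step : σ → α → Option σ
  start : σ
  accept : Set σ

namespace PartialDFA

variable {α σ : Type*} (A : PartialDFA α σ)

/-- The state `p w`, if it is defined. -/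
def run (p : σ) : List α → Option σ
  | [] => some p
  | a :: w => (A.step p a).bind fun q => run q w

/-- The words `w` for which `p w` is defined and is an accepting state. -/
def acceptsFrom (p : σ) : Language α :=
  {w | ∃ q, A.run p w = some q ∧ q ∈ A.accept}

/-- The language accepted by the automaton. -/
def accepts : Language α := A.acceptsFrom A.start

/-- `q` is reachable from `p` in the state transition graph. -/
def Reachable (p q : σ) : Prop := ∃ w : List α, A.run p w = some q

/-- Every state is reachable from the initial one and distinct states are inequivalent. -/
def IsReduced : Prop :=
  (∀ p, A.Reachable A.start p) ∧ ∀ p q, A.acceptsFrom p = A.acceptsFrom q → p = q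

/-- The state transition graph is strongly connected. -/
def IsStronglyConnected : Prop := ∀ p q, A.Reachable p q

/-- The automaton accepts a `k`-testable language. -/
def IsKTestable (k : ℕ) : Prop := A.accepts.IsKTestable k

/-- The automaton is `k`-testable for some positive `k`. -/
def IsLocallyTestable : Prop := ∃ k, A.IsKTestable k

/-- `k` is the order of local testability of the automaton. -/
def IsPreciselyKTestable (k : ℕ) : Prop := IsLeast {j | A.IsKTestable j} k

/-- Nodes of the 2-tuple graph: pairs of distinct states, the second reachable from the first. -/
def TwoTupleNode : Type _ := {x : σ × σ // A.Reachable x.1 x.2 ∧ x.1 ≠ x.2}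

/-- In the 2-tuple graph there is an edge labelled `a` from `x` to `y`. -/
def TwoTupleEdge (a : α) (x y : A.TwoTupleNode) : Prop :=
  A.step x.1.1 a = some y.1.1 ∧ A.step x.1.2 a = some y.1.2

/-- Adjacency in the 2-tuple graph: there is an edge with some label. -/
def twoTupleAdj : SetRel A.TwoTupleNode A.TwoTupleNode := {e | ∃ a, A.TwoTupleEdge a e.1 e.2}

/-- A path on the 2-tuple graph; `φ.length` is its number of edges (possibly zero) and
`φ 0, …, φ φ.length` are its nodes. -/
abbrev TwoTuplePath : Type _ := RelSeries A.twoTupleAdj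

variable {A}

/-- A path without loops: its nodes are pairwise distinct. -/
def TwoTuplePath.IsSimple (φ : A.TwoTuplePath) : Prop := Function.Injective φ

/-- The node lies in a strongly connected component, in the sense in which a component has an edge:
the node lies on a closed path of positive length. -/
def InSCC (x : A.TwoTupleNode) : Prop := ∃ φ : A.TwoTuplePath, 0 < φ.length ∧ φ.head = x ∧ φ.last = x

/-- A path without common nodes with any strongly connected component. -/
def TwoTuplePath.IsStronglySimple (φ : A.TwoTuplePath) : Prop := ∀ i, ¬ InSCC (φ i)

end PartialDFA

/-! Everything rests on `Separates n`, a condition that weakens as `n` decreases. If it fails, the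
last `n` letters read determine the current state, so the test data of order `n + 1` decide
acceptance (`isKTestable_of_not_separates`). If it holds, inserting a loop changes acceptance but
not the test data (`Separates.not_isKTestable`). `Separates n` also means that the 2-tuple graph has
a path of length `n`. Local testability makes this graph acyclic, so all paths are simple and
strongly simple; both maxima are then the largest `n` with `Separates n`, and the order is `n + 2`.
-/

theorem List.isInfix_append_or {α : Type*} {x w y f : List α} (hf : f <:+: x ++ w ++ y)
    (hlen : f.length ≤ w.length + 1) : f <:+: x ++ w ∨ f <:+: w ++ y := by
  obtain ⟨s, t, h⟩ := hf
  by_cases hs : s.length + f.length ≤ x.length + w.length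
  · left
    have h1 : s ++ f <+: x ++ w ++ y := ⟨t, h⟩
    obtain ⟨t', ht'⟩ := List.prefix_of_prefix_length_le h1 (List.prefix_append (x ++ w) y)
      (by simpa using hs)
    exact ⟨s, t', ht'⟩
  · right
    have h1 : x <+: x ++ w ++ y := ⟨w ++ y, by simp⟩
    have h2 : s <+: x ++ w ++ y := ⟨f ++ t, by simpa using h⟩
    obtain ⟨s', rfl⟩ := List.prefix_of_prefix_length_le h1 h2 (by omega)
    exact ⟨s', t, by simpa using h⟩

namespace PartialDFA

variable {α σ : Type*} {A : PartialDFA α σ}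

theorem run_append (p : σ) (u v : List α) :
    A.run p (u ++ v) = (A.run p u).bind fun q => A.run q v := by
  induction u generalizing p with
  | nil => rfl
  | cons a u ih =>
    simp only [List.cons_append, run]
    cases A.step p a with
    | none => rfl
    | some q => exact ih q

theorem run_singleton (p : σ) (a : α) : A.run p [a] = A.step p a := by
  simp [run]

theorem run_append_of_eq_some {p q : σ} {u : List α} (h : A.run p u = some q) (v : List α) :
    A.run p (u ++ v) = A.run q v := by
  rw [run_append, h]
  rfl

theorem exists_of_run_append {p r : σ} {u v : List α} (h : A.run p (u ++ v) = some r) :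
    ∃ q, A.run p u = some q ∧ A.run q v = some r := by
  rw [run_append] at h
  exact Option.bind_eq_some_iff.1 h

variable (A) in
/-- Some word of length `n` leads from two states to two distinct states. -/
def Separates (n : ℕ) : Prop :=
  ∃ (w : List α) (p q p' q' : σ), w.length = n ∧ A.run p w = some p' ∧ A.run q w = some q' ∧
    p' ≠ q'

/-- The last `m` letters separate the two states reached just before them. -/
theorem Separates.mono {m n : ℕ} (h : A.Separates n) (hmn : m ≤ n) : A.Separates m := by
  obtain ⟨w, p, q, p', q', rfl, hp, hq, hne⟩ := h
  rw [← List.take_append_drop (w.length - m) w] at hp hq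
  obtain ⟨r, -, hr⟩ := exists_of_run_append hp
  obtain ⟨t, -, ht⟩ := exists_of_run_append hq
  exact ⟨_, r, t, p', q', by simp; omega, hr, ht, hne⟩

/-- If all words of length `n` synchronize the states, the order of local testability is at most
`n + 1`. -/
theorem isKTestable_of_not_separates {n : ℕ} (h : ¬ A.Separates n) : A.IsKTestable (n + 1) := by
  have sync {w : List α} {p q p' q' : σ} (hw : w.length = n) (hp : A.run p w = some p')
      (hq : A.run q w = some q') : p' = q' := by
    by_contra hne
    exact h ⟨w, p, q, p', q', hw, hp, hq, hne⟩
  -- Let `y` be the last `n` letters of `v`. The factor `y ++ [a]` occurs in `u`, and both runs are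
  -- in the same state after `y`, so the step by `a` in the run of `u` is also available after `v`.
  have defined {i r : σ} {u : List α} (hu : A.run i u = some r) : ∀ v : List α, n ≤ v.length →
      v.take n <+: u → (∀ f, f <:+: v → f.length = n + 1 → f <:+: u) →
      ∃ s, A.run i v = some s := by
    intro v
    induction v using List.reverseRecOn with
    | nil => exact fun _ _ _ => ⟨i, rfl⟩
    | append_singleton v a ih =>
      intro hn hpre hfac
      by_cases hv : n ≤ v.length
      · obtain ⟨s, hs⟩ := ih hv (by rwa [List.take_append_of_le_length hv] at hpre)
          fun f hf => hfac f (hf.trans (List.infix_append_left))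
        have hy : (v.drop (v.length - n)).length = n := by simp; omega
        obtain ⟨e, g, he⟩ := hfac (v.drop (v.length - n) ++ [a])
          ⟨v.take (v.length - n), [], by simp [← List.append_assoc]⟩ (by simp; omega)
        rw [← he] at hu
        obtain ⟨s₁, hs₁, -⟩ := exists_of_run_append hu
        obtain ⟨s₂, -, hs₂⟩ := exists_of_run_append hs₁
        obtain ⟨s₃, hs₃, hstep⟩ := exists_of_run_append hs₂
        have hs' := hs
        rw [← List.take_append_drop (v.length - n) v] at hs'
        obtain ⟨s₄, -, hs₄⟩ := exists_of_run_append hs'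
        obtain rfl := sync hy hs₃ hs₄
        exact ⟨s₁, by rw [run_append_of_eq_some hs, hstep]⟩
      · have hlen : (v ++ [a]).length ≤ n := by simp; omega
        rw [List.take_of_length_le hlen] at hpre
        obtain ⟨t, rfl⟩ := hpre
        exact (exists_of_run_append hu).imp fun _ => And.left
  have key {u v : List α} (huv : SameTestData (n + 1) u v) (hu : u ∈ A.accepts) :
      v ∈ A.accepts := by
    obtain ⟨hpre, hsuf, hfac⟩ := huv
    simp only [Nat.add_sub_cancel] at hpre hsuf
    have hlen := congrArg List.length hpre
    simp only [List.length_take] at hlen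
    by_cases hun : u.length < n
    · rw [List.take_of_length_le (by omega), List.take_of_length_le (by omega)] at hpre
      rwa [← hpre]
    · obtain ⟨r, hr, hacc⟩ := hu
      obtain ⟨s, hs⟩ := defined hr v (by omega) (hpre ▸ List.take_prefix n u)
        fun f hf hl => (hfac.symm.subset ⟨hf, hl⟩ : f ∈ {w | w <:+: u ∧ w.length = n + 1}).1
      refine ⟨s, hs, ?_⟩
      rw [List.rtake, List.rtake] at hsuf
      have hr' := hr
      have hs' := hs
      rw [← List.take_append_drop (u.length - n) u] at hr'
      rw [← List.take_append_drop (v.length - n) v, ← hsuf] at hs'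
      obtain ⟨_, -, hr'⟩ := exists_of_run_append hr'
      obtain ⟨_, -, hs'⟩ := exists_of_run_append hs'
      rwa [← sync (by simp; omega) hr' hs']
  exact ⟨n.succ_pos, fun u v _ _ huv =>
    ⟨key huv, key ⟨huv.1.symm, huv.2.1.symm, huv.2.2.symm⟩⟩⟩

/-- A factor of length `w.length + 1` cannot extend beyond a given copy of `w` on both sides.
Cutting at copies of `w` thus leaves only blocks that occur in both words. -/
theorem sameTestData_loop {a w b c z : List α} :
    SameTestData (w.length + 1) (a ++ w ++ b ++ w ++ c ++ w ++ z)
      (a ++ w ++ b ++ w ++ c ++ w ++ b ++ w ++ z) := by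
  refine ⟨?_, ?_, ?_⟩
  · have hpre (y : List α) : (a ++ w ++ y).take w.length = (a ++ w).take w.length :=
      List.take_append_of_le_length (by simp)
    have h₁ := hpre (b ++ w ++ c ++ w ++ z)
    have h₂ := hpre (b ++ w ++ c ++ w ++ b ++ w ++ z)
    simp only [← List.append_assoc] at h₁ h₂
    rw [Nat.add_sub_cancel, h₁, h₂]
  · have hsuf (x : List α) : (x ++ (w ++ z)).rtake w.length = (w ++ z).rtake w.length := by
      rw [List.rtake, List.rtake, List.drop_append, List.drop_of_length_le (by simp; omega),
        List.nil_append]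
      congr 1
      simp
      omega
    have h₁ := hsuf (a ++ w ++ b ++ w ++ c)
    have h₂ := hsuf (a ++ w ++ b ++ w ++ c ++ w ++ b)
    rw [← List.append_assoc] at h₁ h₂
    rw [Nat.add_sub_cancel, h₁, h₂]
  · ext f
    simp only [Set.mem_ofPred_eq, and_congr_left_iff]
    intro hf
    constructor
    · intro h
      rcases List.isInfix_append_or (x := a ++ w ++ b ++ w ++ c) h hf.le with h | h
      · exact h.trans ⟨[], b ++ w ++ z, by simp⟩
      · exact h.trans ⟨a ++ w ++ b ++ w ++ c ++ w ++ b, [], by simp⟩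
    · intro h
      rcases List.isInfix_append_or (x := a ++ w ++ b ++ w ++ c ++ w ++ b) h hf.le with h | h
      · rw [List.append_assoc _ b w] at h
        rcases List.isInfix_append_or (x := a ++ w ++ b ++ w ++ c) h hf.le with h | h
        · exact h.trans ⟨[], z, by simp⟩
        · exact h.trans ⟨a, c ++ w ++ z, by simp⟩
      · exact h.trans ⟨a ++ w ++ b ++ w ++ c, [], by simp⟩

theorem exists_mem_not_mem_acceptsFrom (hred : A.IsReduced) {p q : σ} (hpq : p ≠ q) :
    ∃ z, (z ∈ A.acceptsFrom p ∧ z ∉ A.acceptsFrom q) ∨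
      (z ∈ A.acceptsFrom q ∧ z ∉ A.acceptsFrom p) := by
  by_contra! h
  exact hpq (hred.2 p q (Set.ext fun z => ⟨(h z).1, (h z).2⟩))

theorem mem_acceptsFrom_append {p q : σ} {u : List α} (h : A.run p u = some q) (z : List α) :
    u ++ z ∈ A.acceptsFrom p ↔ z ∈ A.acceptsFrom q := by
  change (∃ r, A.run p (u ++ z) = some r ∧ _) ↔ ∃ r, A.run q z = some r ∧ _
  rw [run_append_of_eq_some h]

/-- If a word of length `n` does not synchronize the states, the order of local testability
exceeds `n + 1`. -/
theorem Separates.not_isKTestable (hred : A.IsReduced) (hconn : A.IsStronglyConnected) {n : ℕ}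
    (h : A.Separates n) : ¬ A.IsKTestable (n + 1) := by
  have main {w z : List α} {p q p' q' : σ} (hp : A.run p w = some p') (hq : A.run q w = some q')
      (hz : z ∈ A.acceptsFrom p') (hz' : z ∉ A.acceptsFrom q') :
      ¬ A.IsKTestable (w.length + 1) := by
    intro ht
    -- The loop word visits `p`, `p'`, `q`, `q'`, `p`, `p'` before `z`; repeating `b ++ w` moves it
    -- on to `q'`, where `z` is rejected.
    obtain ⟨a, ha⟩ := hred.1 p
    obtain ⟨b, hb⟩ := hconn p' q
    obtain ⟨c, hc⟩ := hconn q' p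
    have h₁ : A.run A.start (a ++ w ++ b ++ w) = some q' := by
      simp only [run_append, ha, Option.bind_some, hp, hb, hq]
    have h₂ : A.run A.start (a ++ w ++ b ++ w ++ c ++ w) = some p' := by
      simp only [run_append, ha, Option.bind_some, hp, hb, hq, hc]
    have h₃ : A.run A.start (a ++ w ++ b ++ w ++ c ++ w ++ b ++ w) = some q' := by
      simp only [run_append, ha, Option.bind_some, hp, hb, hq, hc]
    have hne : ¬ (b = [] ∧ w = []) := by
      rintro ⟨rfl, rfl⟩
      cases hb
      cases hq
      exact hz' hz
    have hiff := ht.2 _ _ (by simp; tauto) (by simp; tauto)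
      (sameTestData_loop (a := a) (w := w) (b := b) (c := c) (z := z))
    exact hz' ((mem_acceptsFrom_append h₃ z).1 (hiff.1 ((mem_acceptsFrom_append h₂ z).2 hz)))
  obtain ⟨w, p, q, p', q', rfl, hp, hq, hne⟩ := h
  obtain ⟨z, ⟨hz, hz'⟩ | ⟨hz, hz'⟩⟩ := exists_mem_not_mem_acceptsFrom hred hne
  · exact main hp hq hz hz'
  · exact main hq hp hz hz'

theorem TwoTuplePath.exists_run (φ : A.TwoTuplePath) : ∃ w : List α, w.length = φ.length ∧
    A.run φ.head.1.1 w = some φ.last.1.1 ∧ A.run φ.head.1.2 w = some φ.last.1.2 := by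
  suffices H : ∀ n (hn : n < φ.length + 1), ∃ w : List α, w.length = n ∧
      A.run φ.head.1.1 w = some (φ ⟨n, hn⟩).1.1 ∧ A.run φ.head.1.2 w = some (φ ⟨n, hn⟩).1.2 from
    H φ.length (Nat.lt_succ_self _)
  intro n
  induction n with
  | zero => exact fun _ => ⟨[], rfl, rfl, rfl⟩
  | succ n ih =>
    intro hn
    obtain ⟨w, hw, h₁, h₂⟩ := ih (by omega)
    obtain ⟨a, ha₁, ha₂⟩ := φ.step ⟨n, by omega⟩
    refine ⟨w ++ [a], by simp [hw], ?_, ?_⟩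
    · rw [run_append_of_eq_some h₁, run_singleton]
      exact ha₁
    · rw [run_append_of_eq_some h₂, run_singleton]
      exact ha₂

theorem TwoTuplePath.separates (φ : A.TwoTuplePath) : A.Separates φ.length := by
  obtain ⟨w, hw, h₁, h₂⟩ := φ.exists_run
  exact ⟨w, _, _, _, _, hw, h₁, h₂, φ.last.2.2⟩

/-- Runs that merge stay merged, so distinct final states force distinct states at every step;
strong connectivity makes each such pair a node. -/
theorem Separates.exists_path (hconn : A.IsStronglyConnected) {n : ℕ} (h : A.Separates n) :
    ∃ φ : A.TwoTuplePath, φ.length = n := by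
  suffices H : ∀ (w : List α) (p q p' q' : σ) (hpq : p ≠ q), A.run p w = some p' →
      A.run q w = some q' → p' ≠ q' →
      ∃ φ : A.TwoTuplePath, φ.length = w.length ∧ φ.head = ⟨(p, q), hconn p q, hpq⟩ by
    obtain ⟨w, p, q, p', q', rfl, hp, hq, hne⟩ := h
    have hpq : p ≠ q := by
      rintro rfl
      exact hne (Option.some_injective _ (hp.symm.trans hq))
    exact (H w p q p' q' hpq hp hq hne).imp fun _ => And.left
  intro w
  induction w with
  | nil => exact fun p q p' q' hpq _ _ _ => ⟨RelSeries.singleton _ _, rfl, rfl⟩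
  | cons a w ih =>
    intro p q p' q' hpq hp hq hne
    obtain ⟨r, hr, hp⟩ := Option.bind_eq_some_iff.1 hp
    obtain ⟨t, ht, hq⟩ := Option.bind_eq_some_iff.1 hq
    have hrt : r ≠ t := by
      rintro rfl
      exact hne (Option.some_injective _ (hp.symm.trans hq))
    obtain ⟨φ, hφ, hhead⟩ := ih r t p' q' hrt hp hq hne
    have hedge : (⟨(p, q), hconn p q, hpq⟩, φ.head) ∈ A.twoTupleAdj :=
      ⟨a, by rw [hhead]; exact ⟨hr, ht⟩⟩
    exact ⟨φ.cons _ hedge, (RelSeries.cons_length _ _ _).trans (congrArg (· + 1) hφ),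
      RelSeries.head_cons _ _ _⟩

/-- Going round the closed path repeatedly yields arbitrarily long words that fix both states. -/
theorem InSCC.separates {x : A.TwoTupleNode} (hx : InSCC x) (n : ℕ) : A.Separates n := by
  obtain ⟨φ, hpos, hhead, hlast⟩ := hx
  obtain ⟨w, hw, h₁, h₂⟩ := φ.exists_run
  rw [hhead, hlast] at h₁ h₂
  have H : ∀ m, ∃ u : List α, m ≤ u.length ∧ A.run x.1.1 u = some x.1.1 ∧
      A.run x.1.2 u = some x.1.2 := by
    intro m
    induction m with
    | zero => exact ⟨[], le_rfl, rfl, rfl⟩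
    | succ m ih =>
      obtain ⟨u, hu, hu₁, hu₂⟩ := ih
      exact ⟨u ++ w, by simp; omega, by rw [run_append_of_eq_some hu₁, h₁],
        by rw [run_append_of_eq_some hu₂, h₂]⟩
  obtain ⟨u, hu, hu₁, hu₂⟩ := H n
  exact Separates.mono ⟨u, _, _, _, _, rfl, hu₁, hu₂, x.2.2⟩ hu

/-- The 2-tuple graph of a locally testable strongly connected automaton is acyclic. -/
theorem not_inSCC (hred : A.IsReduced) (hloc : A.IsLocallyTestable)
    (hconn : A.IsStronglyConnected) (x : A.TwoTupleNode) : ¬ InSCC x := by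
  intro hx
  obtain ⟨k, hk⟩ := hloc
  obtain ⟨n, rfl⟩ := Nat.exists_eq_succ_of_ne_zero hk.1.ne'
  exact (hx.separates n).not_isKTestable hred hconn hk

theorem TwoTuplePath.IsStronglySimple.isSimple {φ : A.TwoTuplePath} (h : φ.IsStronglySimple) :
    φ.IsSimple := by
  refine Function.Injective.of_lt_imp_ne fun i j hij heq => h i ?_
  have hij' : (i : ℕ) < j := hij
  -- The segment between two visits to a node is a closed path.
  refine ⟨⟨j - i, fun t => φ ⟨i + t, by omega⟩, fun t => φ.step ⟨i + t, by omega⟩⟩, ?_, ?_, ?_⟩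
  · change 0 < (j : ℕ) - i
    omega
  · rfl
  · rw [heq]
    change φ _ = φ _
    congr 1
    ext
    change (i : ℕ) + (j - i) = j
    omega

theorem isPreciselyKTestable_of_separates (hred : A.IsReduced) (hconn : A.IsStronglyConnected)
    {n : ℕ} (h : A.Separates n) (h' : ¬ A.Separates (n + 1)) : A.IsPreciselyKTestable (n + 2) := by
  refine ⟨isKTestable_of_not_separates h', fun j hj => ?_⟩
  by_contra! hlt
  obtain ⟨m, rfl⟩ := Nat.exists_eq_succ_of_ne_zero hj.1.ne'
  exact (h.mono (by omega : m ≤ n)).not_isKTestable hred hconn hj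

theorem isPreciselyKTestable_of_isGreatest (hred : A.IsReduced) (hconn : A.IsStronglyConnected)
    {P : A.TwoTuplePath → Prop} (hP : ∀ φ, P φ) {n : ℕ}
    (h : IsGreatest {n | ∃ φ : A.TwoTuplePath, P φ ∧ φ.length = n} n) :
    A.IsPreciselyKTestable (n + 2) := by
  obtain ⟨⟨φ, -, rfl⟩, hmax⟩ := h
  refine isPreciselyKTestable_of_separates hred hconn φ.separates fun hs => ?_
  obtain ⟨ψ, hψ⟩ := hs.exists_path hconn
  have := hmax ⟨ψ, hP ψ, hψ⟩
  omega

end PartialDFA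

theorem theorem3p11 {α σ : Type*} [Finite σ] (A : PartialDFA α σ)
    (hred : A.IsReduced) (hloc : A.IsLocallyTestable) (hconn : A.IsStronglyConnected)
    (k : ℕ) (hk : 2 ≤ k) :
    (IsGreatest {n | ∃ φ : A.TwoTuplePath, φ.IsStronglySimple ∧ φ.length = n} (k - 2) →
      A.IsPreciselyKTestable k) ∧
    (IsGreatest {n | ∃ φ : A.TwoTuplePath, φ.IsSimple ∧ φ.length = n} (k - 2) →
      A.IsPreciselyKTestable k) := by
  obtain ⟨n, rfl⟩ := Nat.exists_eq_add_of_le' hk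
  have hss (φ : A.TwoTuplePath) : φ.IsStronglySimple := fun i =>
    PartialDFA.not_inSCC hred hloc hconn (φ i)
  exact ⟨PartialDFA.isPreciselyKTestable_of_isGreatest hred hconn hss,
    PartialDFA.isPreciselyKTestable_of_isGreatest hred hconn fun φ => (hss φ).isSimple⟩
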